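/- **Setting.** Let $K\ge 1$, and let $n_0=n_T$, $n_k=n_S$ for $k\in[K]=\{1,\dots,K\}$, $N=Kn_S+n_T$. One observes $y^{(k)}=X^{(k)}(\beta+\delta^{(k)})+\varepsilon^{(k)}\in\mathbb R^{n_k}$ for $0\le k\le K$, where $\delta^{(0)}=0$, $\beta,\delta^{(1)},\dots,\delta^{(K)}\in\mathbb R^p$ are fixed, and: (A1) the rows $X^{(k)}_{i\cdot}$ ($0\le k\le K$, $1\le i\le n_k$) are independent, mean-zero, sub-Gaussian random vectors with common sub-Gaussian parameter $\kappa$ (that is, $\mathbb E\, e^{t\langle u,X^{(k)}_{i\cdot}\rangle}\le e^{\kappa t^2/2}$ for all $t\in\mathbb R$ and all unit vectors $u$), with covariance $\Sigma^{(k)}$ all of whose eigenvalues lie in $[1/c_X,c_X]$; (A2) the $\varepsilon^{(k)}_i$ are independent centred Gaussian variables with variance $\sigma_k\le c_\varepsilon$ in task $k$, and the noise is independent of the design. Put $S_0=\{j:\beta_j\ne0\}$ and $S_k=\{j:\delta^{(k)}_j\neq 0\}$. An *oracle estimator* is a minimizer $(b,d^{(1)},\dots,d^{(K)})$ of $\frac1N\sum_{k=0}^K\|y^{(k)}-X^{(k)}(b+d^{(k)})\|_2^2$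 (with $d^{(0)}=0$) subject to $b_{S_0^c}=0$ and $d^{(k)}_{S_k^c}=0$ for $k\in[K]$. The *weighted fused Lasso* with weights $w^{(k)}_j$ is $$\min_{b,d^{(1)},\dots,d^{(K)}}\ \frac1N\sum_{k=0}^K\|y^{(k)}-X^{(k)}(b+d^{(k)})\|_2^2+\lambda_0\sum_{j=1}^p w^{(0)}_j|b_j|+\lambda_1\sum_{k=1}^K\sum_{j=1}^p w^{(k)}_j|d^{(k)}_j| .$$ A family of *folded-concave penalties* with constants $a>a_2\ge0$, $a_1>0$ is a family $(\mathcal R_\lambda)_{\lambda>0}$ of nondecreasing concave differentiable functions on $[0,\infty)$ (with right derivative at $0$) such that $\mathcal R_\lambda(0)=0$, $\mathcal R_\lambda'(t)\ge a_1\lambda$ for $0\le t\le a_2\lambda$, and $\mathcal R'_\lambda(t)=0$ for $t\ge a\lambda$. **Theorem.** Fix constants $c_X>0$, $\kappa$, $c_\varepsilon$, $c_n>0$, $M$, $a>a_2\ge0$, $a_1>0$. There are constants $C_0,C_1,c_1>0$ depending only on these such that the following holds for all $K\ge1$, $n_T$, $n_S$, $p$ with $n_S\ge c_n\log p$ and $\log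 K\le M\log p$. Assume (A1) and (A2), let $\lambda_0,\lambda_1>0$ satisfy $$\lambda_0\ge C_0\sqrt{\frac{\log p}{N}},\qquad \lambda_1\ge C_1\,\frac{n_S}{N}\sqrt{\frac{\log p}{n_S}},$$ and let $h_0^\wedge\ge\frac{3a}{2}\lambda_0$ and $h_k^\wedge\ge\frac{3a}2\lambda_1$ for $k\in[K]$. Suppose $(\beta,\delta^{(1)},\dots,\delta^{(K)})\in\Theta_1$, that is, $|\beta_j|\ge h_0^\wedge$ for $j\in S_0$ and $|\delta^{(k)}_j|\ge h_k^\wedge$ for $j\in S_k$, $k\in[K]$. Let $(\mathcal R_\lambda)$ be a family of folded-concave penalties with constants $a,a_1,a_2$, let $\hat\beta_{\rm init}$, $\hat\delta^{(k)}_{\rm init}$ be (random) initial estimators, and use the weights $$w^{(0)}_j=\lambda_0^{-1}\mathcal R'_{\lambda_0}(|\hat\beta_{{\rm init},j}|),\qquad w^{(k)}_j=\lambda_1^{-1}\mathcal R'_{\lambda_1}(|\hat\delta^{(k)}_{{\rm init},j}|).$$ Then there is an event of probability at least $1-\exp(-c_1\log p)$ on which, whenever the initial estimators satisfy $$\|\hat\beta_{\rm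 init}-\beta\|_\infty\le\tfrac{a_2}2\lambda_0,\qquad \|\hat\delta^{(k)}_{\rm init}-\delta^{(k)}\|_\infty\le\tfrac{a_2}2\lambda_1\quad(k\in[K]),$$ the weighted fused Lasso has a solution and its solutions are exactly the oracle estimators. In particular, if the initial estimators always satisfy these bounds, the weighted fused-Lasso solution is the oracle estimator with probability at least $1-\exp(-c_1\log p)$. -/

import Mathlib

namespace AdaTrans

open MeasureTheory ProbabilityTheory

/-- Sample sizes: task `0` is the target (size `nT`), tasks `1, …, K` are the sources (size `nS`). -/
def taskSize (K nT nS : ℕ) : Fin (K + 1) → ℕ := Fin.cons nT (fun _ => nS)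

/-- The index set of all observations: pairs (task `k`, observation `i` of task `k`). -/
abbrev Obs (K nT nS : ℕ) : Type := Σ k : Fin (K + 1), Fin (taskSize K nT nS k)

/-- The total sample size `N = K nS + nT`. -/
def totalSize (K nT nS : ℕ) : ℕ := K * nS + nT

/-- A family of contrasts `δ⁽¹⁾, …, δ⁽ᴷ⁾`, extended by `δ⁽⁰⁾ = 0`. -/
def extend {K p : ℕ} (d : Fin K → Fin p → ℝ) : Fin (K + 1) → Fin p → ℝ := Fin.cons 0 d

/-- The response of the linear model `y⁽ᵏ⁾ = X⁽ᵏ⁾ (β + δ⁽ᵏ⁾) + ε⁽ᵏ⁾` (with `δ⁽⁰⁾ = 0`). -/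
def response {K nT nS p : ℕ} (X : Obs K nT nS → Fin p → ℝ) (eps : Obs K nT nS → ℝ)
    (β : Fin p → ℝ) (δ : Fin K → Fin p → ℝ) : Obs K nT nS → ℝ :=
  fun o => X o ⬝ᵥ (β + extend δ o.1) + eps o

/-- A centred random vector is sub-Gaussian with parameter `κ` if all its one-dimensional marginals
along Euclidean unit vectors `u` satisfy `E exp(t ⟨u, V⟩) ≤ exp(κ t² / 2)` for every real `t`. -/
def IsSubGaussianVector {Ω : Type*} [MeasurableSpace Ω] {p : ℕ} (V : Ω → Fin p → ℝ) (κ : NNReal)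
    (μ : Measure Ω) : Prop :=
  ∀ u : Fin p → ℝ, ∑ j, u j ^ 2 = 1 → HasSubgaussianMGF (fun ω => u ⬝ᵥ V ω) κ μ

/-- The assumption on the design: the rows are independent, centred, sub-Gaussian, the rows of
task `k` have covariance matrix `Sig k`, and all eigenvalues of all these matrices lie
in `[1/c, c]`. -/
structure DesignAssumption {Ω : Type*} [MeasurableSpace Ω] {K nT nS p : ℕ} (μ : Measure Ω)
    (X : Obs K nT nS → Ω → Fin p → ℝ) (Sig : Fin (K + 1) → Matrix (Fin p) (Fin p) ℝ)
    (κ : NNReal) (c : ℝ) : Prop where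
  measurable : ∀ o, Measurable (X o)
  indep : iIndepFun X μ
  subGaussian : ∀ o, IsSubGaussianVector (X o) κ μ
  mean_zero : ∀ o j, ∫ ω, X o ω j ∂μ = 0
  covariance : ∀ o j l, ∫ ω, X o ω j * X o ω l ∂μ = Sig o.1 j l
  symm : ∀ k, (Sig k).IsSymm
  eigenvalues : ∀ k t, Module.End.HasEigenvalue (Matrix.toLin' (Sig k)) t → 1 / c ≤ t ∧ t ≤ c

/-- The assumption on the noise: independent centred Gaussian variables, with variance
`v k ≤ c` in task `k`, independent of the design. -/
structure NoiseAssumption {Ω : Type*} [MeasurableSpace Ω] {K nT nS p : ℕ} (μ : Measure Ω)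
    (X : Obs K nT nS → Ω → Fin p → ℝ) (eps : Obs K nT nS → Ω → ℝ) (v : Fin (K + 1) → NNReal)
    (c : ℝ) : Prop where
  measurable : ∀ o, Measurable (eps o)
  indep : iIndepFun eps μ
  gaussian : ∀ o, HasLaw (eps o) (gaussianReal 0 (v o.1)) μ
  variance_le : ∀ k, (v k : ℝ) ≤ c
  indep_design : IndepFun (fun ω o => eps o ω) (fun ω o => X o ω) μ

/-- The parameter space of pairs `(β, (δ⁽ᵏ⁾)ₖ)` whose nonzero entries have absolute value at
least `h0` (for `β`) and `h k` (for `δ⁽ᵏ⁾`). -/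
def Theta1 {K p : ℕ} (h0 : ℝ) (h : Fin K → ℝ) : Set ((Fin p → ℝ) × (Fin K → Fin p → ℝ)) :=
  {θ | (∀ j, θ.1 j ≠ 0 → h0 ≤ |θ.1 j|) ∧ ∀ k j, θ.2 k j ≠ 0 → h k ≤ |θ.2 k j|}

/-- The derivative `R'_lam(t)` for `t ≥ 0` of a penalty; at `t = 0` it is the right derivative. -/
noncomputable def penaltyDeriv (R : ℝ → ℝ → ℝ) (lam t : ℝ) : ℝ :=
  derivWithin (R lam) (Set.Ici 0) t

/-- Folded-concave penalties with constants `a`, `a₁`, `a₂`. Only the values `R lam t` with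
`lam > 0`, `t ≥ 0` matter; the penalty of a real number `x` is `R lam |x|`. -/
structure IsFoldedConcave (R : ℝ → ℝ → ℝ) (a a₁ a₂ : ℝ) : Prop where
  zero : ∀ lam > 0, R lam 0 = 0
  mono : ∀ lam > 0, MonotoneOn (R lam) (Set.Ici 0)
  concave : ∀ lam > 0, ConcaveOn ℝ (Set.Ici 0) (R lam)
  diff : ∀ lam > 0, DifferentiableOn ℝ (R lam) (Set.Ici 0)
  deriv_ge : ∀ lam > 0, ∀ t, 0 ≤ t → t ≤ a₂ * lam → a₁ * lam ≤ penaltyDeriv R lam t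
  deriv_eq_zero : ∀ lam > 0, ∀ t, a * lam ≤ t → penaltyDeriv R lam t = 0

/-- The weight `lam⁻¹ R'_lam(|x|)` attached to an initial estimate `x` of a coordinate. -/
noncomputable def weight (R : ℝ → ℝ → ℝ) (lam x : ℝ) : ℝ := lam⁻¹ * penaltyDeriv R lam |x|

/-- The fit term `N⁻¹ ∑ₖ ‖y⁽ᵏ⁾ - X⁽ᵏ⁾ (b + d⁽ᵏ⁾)‖₂²` (with `d⁽⁰⁾ = 0`). -/
noncomputable def loss {K nT nS p : ℕ} (X : Obs K nT nS → Fin p → ℝ) (y : Obs K nT nS → ℝ)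
    (θ : (Fin p → ℝ) × (Fin K → Fin p → ℝ)) : ℝ :=
  (1 / (totalSize K nT nS : ℝ)) *
    ∑ k : Fin (K + 1), ∑ i : Fin (taskSize K nT nS k),
      (y ⟨k, i⟩ - X ⟨k, i⟩ ⬝ᵥ (θ.1 + extend θ.2 k)) ^ 2

/-- The weighted fused-Lasso objective. -/
noncomputable def objective {K nT nS p : ℕ} (X : Obs K nT nS → Fin p → ℝ) (y : Obs K nT nS → ℝ)
    (lam0 lam1 : ℝ) (w0 : Fin p → ℝ) (w : Fin K → Fin p → ℝ)
    (θ : (Fin p → ℝ) × (Fin K → Fin p → ℝ)) : ℝ :=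
  loss X y θ + lam0 * ∑ j, w0 j * |θ.1 j| + lam1 * ∑ k, ∑ j, w k j * |θ.2 k j|

/-- The solutions of the weighted fused-Lasso problem. -/
def lassoSolutions {K nT nS p : ℕ} (X : Obs K nT nS → Fin p → ℝ) (y : Obs K nT nS → ℝ)
    (lam0 lam1 : ℝ) (w0 : Fin p → ℝ) (w : Fin K → Fin p → ℝ) :
    Set ((Fin p → ℝ) × (Fin K → Fin p → ℝ)) :=
  {θ | ∀ θ', objective X y lam0 lam1 w0 w θ ≤ objective X y lam0 lam1 w0 w θ'}

/-- The feasible set of the oracle problem: the zero pattern of the true parameters `(β, δ)`. -/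
def oracleFeasible {K p : ℕ} (β : Fin p → ℝ) (δ : Fin K → Fin p → ℝ) :
    Set ((Fin p → ℝ) × (Fin K → Fin p → ℝ)) :=
  {θ | (∀ j, β j = 0 → θ.1 j = 0) ∧ ∀ k j, δ k j = 0 → θ.2 k j = 0}

/-- The oracle estimators: the solutions of least squares restricted to the true supports. -/
def oracleSolutions {K nT nS p : ℕ} (X : Obs K nT nS → Fin p → ℝ) (y : Obs K nT nS → ℝ)
    (β : Fin p → ℝ) (δ : Fin K → Fin p → ℝ) : Set ((Fin p → ℝ) × (Fin K → Fin p → ℝ)) :=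
  {θ | θ ∈ oracleFeasible β δ ∧ ∀ θ' ∈ oracleFeasible β δ, loss X y θ ≤ loss X y θ'}

/-- Sup-norm accuracy of initial values, to within `(a₂/2) lam0` and `(a₂/2) lam1`. (The norm of
`Fin p → ℝ` is the sup norm.) -/
def Accurate {K p : ℕ} (a₂ lam0 lam1 : ℝ) (β : Fin p → ℝ) (δ : Fin K → Fin p → ℝ)
    (b0 : Fin p → ℝ) (d0 : Fin K → Fin p → ℝ) : Prop :=
  ‖b0 - β‖ ≤ a₂ / 2 * lam0 ∧ ∀ k, ‖d0 k - δ k‖ ≤ a₂ / 2 * lam1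

end AdaTrans

/-!
Stacking `β` and the contrasts `δ⁽ᵏ⁾` turns the fused Lasso into a single weighted Lasso. Accurate
initial values and the minimal signal strength make the folded-concave weights vanish on the true
support and be at least `a₁` off it. For such weights the optimality conditions reduce to one
inequality per coefficient off the support: if the inner product of its column with the oracle
residual is strictly below its penalty level, the Lasso minimizers are exactly the least-squares
fits on the true support. The oracle residual is the noise projected off the active columns, so
given the design this inner product is sub-Gaussian with variance proxy at most `c ‖column‖²`. A
Chernoff bound for sums of squares controls the column norms, and a union bound over the `p + K p`
coefficients costs only a power of `p`, since `log K ≤ M log p`.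
-/

namespace AdaTrans

open MeasureTheory ProbabilityTheory Finset
open scoped RealInnerProductSpace NNReal

lemma mul_abs_sub_mul_nonneg {v w : ℝ} (h : |v| ≤ w) (x : ℝ) : 0 ≤ w * |x| - x * v := by
  nlinarith [le_abs_self (x * v), abs_mul x v, mul_le_mul_of_nonneg_right h (abs_nonneg x)]

lemma mul_abs_sub_mul_pos {v w x : ℝ} (h : |v| < w) (hx : x ≠ 0) : 0 < w * |x| - x * v := by
  nlinarith [le_abs_self (x * v), abs_mul x v, mul_lt_mul_of_pos_right h (abs_pos.2 hx)]

section Projection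

variable {J F : Type*} [Finite J] [NormedAddCommGroup F] [InnerProductSpace ℝ F]

/-- The span of the columns `z j` with `j ∈ S`: the fitted values of the regression on `S`. -/
def columnSpan (z : J → F) (S : Set J) : Submodule ℝ F := Submodule.span ℝ (z '' S)

instance (z : J → F) (S : Set J) : FiniteDimensional ℝ (columnSpan z S) :=
  FiniteDimensional.span_of_finite ℝ (S.toFinite.image z)

/-- The residual of the least-squares regression on the columns `z j` with `j ∈ S`, as a linear map
of the response. -/
noncomputable def residual (z : J → F) (S : Set J) : F →L[ℝ] F := (columnSpan z S)ᗮ.starProjection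

lemma residual_eq_zero {z : J → F} {S : Set J} {u : F} (hu : u ∈ columnSpan z S) :
    residual z S u = 0 :=
  Submodule.starProjection_orthogonal_apply_eq_zero hu

lemma residual_column_eq_zero {z : J → F} {S : Set J} {j : J} (hj : j ∈ S) :
    residual z S (z j) = 0 :=
  residual_eq_zero (Submodule.subset_span (Set.mem_image_of_mem z hj))

lemma inner_residual_left (z : J → F) (S : Set J) (u v : F) :
    ⟪residual z S u, v⟫ = ⟪u, residual z S v⟫ :=
  Submodule.inner_starProjection_left_eq_right _ u v

lemma residual_residual (z : J → F) (S : Set J) (v : F) :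
    residual z S (residual z S v) = residual z S v :=
  Submodule.starProjection_eq_self_iff.2 (Submodule.starProjection_apply_mem _ v)

lemma norm_residual_le (z : J → F) (S : Set J) (v : F) : ‖residual z S v‖ ≤ ‖v‖ :=
  Submodule.norm_starProjection_apply_le _ v

lemma sub_residual_mem_columnSpan (z : J → F) (S : Set J) (v : F) :
    v - residual z S v ∈ columnSpan z S := by
  rw [residual, Submodule.starProjection_orthogonal_val, sub_sub_cancel]
  exact Submodule.starProjection_apply_mem _ v

lemma abs_correlation_le {z : J → F} {y : F} {s : ℝ} {W : J → ℝ} {S : Set J}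
    (hWS : ∀ j ∈ S, W j = 0) (hW : ∀ j ∉ S, |2 * s * ⟪z j, residual z S y⟫| < W j) (j : J) :
    |2 * s * ⟪z j, residual z S y⟫| ≤ W j := by
  by_cases hj : j ∈ S
  · simp [← inner_residual_left, residual_column_eq_zero hj, hWS j hj]
  · exact (hW j hj).le

lemma inner_residual_eq_polarization (z : J → F) (S : Set J) (u v : F) :
    ⟪residual z S u, v⟫ = (‖residual z S (u + v)‖ * ‖residual z S (u + v)‖ -
      ‖residual z S (u - v)‖ * ‖residual z S (u - v)‖) / 4 := by
  have hidem : ⟪residual z S u, v⟫ = ⟪residual z S u, residual z S v⟫ := by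
    rw [inner_residual_left z S u (residual z S v), residual_residual, inner_residual_left]
  rw [hidem, map_add, map_sub, norm_add_mul_self_real, norm_sub_mul_self_real]
  ring

end Projection

section Fit

variable {J F : Type*} [Fintype J] [NormedAddCommGroup F] [InnerProductSpace ℝ F]

lemma mem_columnSpan_iff {z : J → F} {S : Set J} {u : F} :
    u ∈ columnSpan z S ↔ ∃ c : J → ℝ, Function.support c ⊆ S ∧ ∑ j, c j • z j = u := by
  constructor
  · intro hu
    obtain ⟨l, hl, rfl⟩ := (Finsupp.mem_span_image_iff_linearCombination ℝ).1 hu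
    refine ⟨l, by simpa [Finsupp.mem_supported] using hl, ?_⟩
    rw [Finsupp.linearCombination_apply]
    exact (Finsupp.sum_fintype l (fun j a => a • z j) fun _ => zero_smul ℝ _).symm
  · rintro ⟨c, hc, rfl⟩
    refine Submodule.sum_mem _ fun j _ => ?_
    by_cases hj : c j = 0
    · simp [hj]
    · exact Submodule.smul_mem _ _ (Submodule.subset_span ⟨j, hc hj, rfl⟩)

lemma exists_sub_sum_eq_residual (z : J → F) (S : Set J) (y : F) :
    ∃ c : J → ℝ, Function.support c ⊆ S ∧ y - ∑ j, c j • z j = residual z S y := by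
  obtain ⟨c, hc, hfit⟩ := mem_columnSpan_iff.1 (sub_residual_mem_columnSpan z S y)
  exact ⟨c, hc, by rw [hfit, sub_sub_cancel]⟩

lemma norm_residual_eq_iInf (z : J → F) (S : Set J) (v : F) :
    ‖residual z S v‖ = ⨅ c : {c : J → ℝ // Function.support c ⊆ S}, ‖v - ∑ j, c.1 j • z j‖ := by
  rw [residual, Submodule.starProjection_orthogonal_val, Submodule.starProjection_minimal]
  symm
  refine Function.Surjective.iInf_congr
    (fun c => ⟨_, mem_columnSpan_iff.2 ⟨c.1, c.2, rfl⟩⟩) ?_ fun _ => rfl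
  rintro ⟨u, hu⟩
  obtain ⟨c, hc, rfl⟩ := mem_columnSpan_iff.1 hu
  exact ⟨⟨c, hc⟩, rfl⟩

lemma norm_residual_sq_le (z : J → F) (S : Set J) (y : F) (c : J → ℝ) :
    ‖residual z S y‖ ^ 2 ≤
      ‖y - ∑ j, c j • z j‖ ^ 2 + 2 * ∑ j, c j * ⟪z j, residual z S y⟫ := by
  have hortho : ⟪residual z S y, y - residual z S y⟫ = 0 := by
    rw [inner_residual_left, residual_eq_zero (sub_residual_mem_columnSpan z S y), inner_zero_right]
  have hsplit : y - ∑ j, c j • z j =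
      residual z S y + (y - residual z S y - ∑ j, c j • z j) := by abel
  have hcross : ⟪residual z S y, y - residual z S y - ∑ j, c j • z j⟫ =
      -∑ j, c j * ⟪z j, residual z S y⟫ := by
    simp only [inner_sub_right, hortho, inner_sum, inner_smul_right, zero_sub,
      real_inner_comm (residual z S y)]
  rw [hsplit, norm_add_sq_real, hcross]
  nlinarith [sq_nonneg ‖y - residual z S y - ∑ j, c j • z j‖]

end Fit

section Measurability

variable {α J F : Type*} [MeasurableSpace α] [Finite J] [NormedAddCommGroup F]
  [InnerProductSpace ℝ F] [MeasurableSpace F] [BorelSpace F] [SecondCountableTopology F]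
  {z : α → J → F} {u v : α → F}

-- `residual z S v` is discontinuous in `z` where the columns become dependent, but its norm is an
-- infimum of continuous functions of `(z, v)`.
lemma measurable_norm_residual (hz : Measurable z) (hv : Measurable v) (S : Set J) :
    Measurable fun a => ‖residual (z a) S (v a)‖ := by
  have hjoint : Measurable fun q : (J → F) × F => ‖residual q.1 S q.2‖ := by
    cases nonempty_fintype J
    simp only [norm_residual_eq_iInf]
    refine UpperSemicontinuous.measurable (upperSemicontinuous_ciInf
      (fun q => ⟨0, by rintro _ ⟨c, rfl⟩; positivity⟩) fun c => Continuous.upperSemicontinuous ?_)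
    fun_prop
  exact (hjoint.comp (hz.prodMk hv) :)

lemma measurable_inner_residual (hz : Measurable z) (hu : Measurable u) (hv : Measurable v)
    (S : Set J) : Measurable fun a => ⟪residual (z a) S (u a), v a⟫ := by
  simp only [inner_residual_eq_polarization]
  have hadd := measurable_norm_residual hz (hu.add hv) S
  have hsub := measurable_norm_residual hz (hu.sub hv) S
  exact ((hadd.mul hadd).sub (hsub.mul hsub)).div_const 4

end Measurability

section Lasso

variable {J F : Type*} [Fintype J] [NormedAddCommGroup F] [InnerProductSpace ℝ F]

/-- The weighted Lasso objective with columns `z`, response `y`, scale `s` of the squared loss and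
penalty weights `W`; at `W = 0` it is the least-squares objective. -/
noncomputable def lassoObjective (z : J → F) (y : F) (s : ℝ) (W c : J → ℝ) : ℝ :=
  s * ‖y - ∑ j, c j • z j‖ ^ 2 + ∑ j, W j * |c j|

variable {z : J → F} {y : F} {s : ℝ} {W : J → ℝ} {S : Set J}

lemma lassoObjective_eq_of_support_subset (hWS : ∀ j ∈ S, W j = 0) {c : J → ℝ}
    (hc : Function.support c ⊆ S) : lassoObjective z y s W c = lassoObjective z y s 0 c := by
  have hpen : ∀ j, W j * |c j| = 0 := fun j => by
    by_cases hj : j ∈ S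
    · rw [hWS j hj, zero_mul]
    · rw [Function.support_subset_iff'.1 hc j hj, abs_zero, mul_zero]
  simp [lassoObjective, hpen]

lemma residual_add_sum_le_lassoObjective (hs : 0 ≤ s) (c : J → ℝ) :
    s * ‖residual z S y‖ ^ 2 + ∑ j, (W j * |c j| - c j * (2 * s * ⟪z j, residual z S y⟫)) ≤
      lassoObjective z y s W c := by
  have hfit := mul_le_mul_of_nonneg_left (norm_residual_sq_le z S y c) hs
  have hsum : ∑ j, c j * (2 * s * ⟪z j, residual z S y⟫) =
      s * (2 * ∑ j, c j * ⟪z j, residual z S y⟫) := by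
    simp only [mul_sum]
    exact sum_congr rfl fun j _ => by ring
  rw [sum_sub_distrib, hsum, lassoObjective]
  linarith

lemma residual_le_lassoObjective (hs : 0 ≤ s) (hWS : ∀ j ∈ S, W j = 0)
    (hW : ∀ j ∉ S, |2 * s * ⟪z j, residual z S y⟫| < W j) (c : J → ℝ) :
    s * ‖residual z S y‖ ^ 2 ≤ lassoObjective z y s W c :=
  (le_add_of_nonneg_right (sum_nonneg fun j _ =>
    mul_abs_sub_mul_nonneg (abs_correlation_le hWS hW j) (c j))).trans
      (residual_add_sum_le_lassoObjective hs c)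

lemma support_subset_of_lassoObjective_le (hs : 0 ≤ s) (hWS : ∀ j ∈ S, W j = 0)
    (hW : ∀ j ∉ S, |2 * s * ⟪z j, residual z S y⟫| < W j) {c : J → ℝ}
    (hc : lassoObjective z y s W c ≤ s * ‖residual z S y‖ ^ 2) : Function.support c ⊆ S := by
  have hgap := fun j => mul_abs_sub_mul_nonneg (abs_correlation_le hWS hW j) (c j)
  have hlow := (residual_add_sum_le_lassoObjective (S := S) hs c).trans hc
  have hsum := le_antisymm (add_le_iff_nonpos_right _ |>.1 hlow) (sum_nonneg fun j _ => hgap j)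
  rw [sum_eq_zero_iff_of_nonneg fun j _ => hgap j] at hsum
  exact Function.support_subset_iff'.2 fun j hj => by_contra fun hcj =>
    (mul_abs_sub_mul_pos (hW j hj) hcj).ne' (hsum j (mem_univ j))

lemma exists_lassoObjective_eq (hWS : ∀ j ∈ S, W j = 0) : ∃ c : J → ℝ,
    Function.support c ⊆ S ∧ lassoObjective z y s W c = s * ‖residual z S y‖ ^ 2 := by
  obtain ⟨c, hc, hfit⟩ := exists_sub_sum_eq_residual z S y
  exact ⟨c, hc, by rw [lassoObjective_eq_of_support_subset hWS hc]; simp [lassoObjective, hfit]⟩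

theorem exists_isMinOn_lassoObjective (hs : 0 ≤ s) (hWS : ∀ j ∈ S, W j = 0)
    (hW : ∀ j ∉ S, |2 * s * ⟪z j, residual z S y⟫| < W j) :
    ∃ c, IsMinOn (lassoObjective z y s W) Set.univ c := by
  obtain ⟨c, -, hc⟩ := exists_lassoObjective_eq (z := z) (y := y) (s := s) hWS
  exact ⟨c, fun c' _ => hc.trans_le (residual_le_lassoObjective hs hWS hW c')⟩

theorem isMinOn_lassoObjective_iff (hs : 0 ≤ s) (hWS : ∀ j ∈ S, W j = 0)
    (hW : ∀ j ∉ S, |2 * s * ⟪z j, residual z S y⟫| < W j) {c : J → ℝ} :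
    IsMinOn (lassoObjective z y s W) Set.univ c ↔
      Function.support c ⊆ S ∧
        IsMinOn (lassoObjective z y s 0) {c' | Function.support c' ⊆ S} c := by
  obtain ⟨c₀, hc₀, hmin⟩ := exists_lassoObjective_eq (z := z) (y := y) (s := s) hWS
  constructor
  · intro h
    have hc := support_subset_of_lassoObjective_le hs hWS hW ((h (Set.mem_univ c₀)).trans hmin.le)
    refine ⟨hc, fun c' (hc' : Function.support c' ⊆ S) => ?_⟩
    have hle := h (Set.mem_univ c')
    simpa only [Set.mem_ofPred_eq, lassoObjective_eq_of_support_subset hWS hc,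
      lassoObjective_eq_of_support_subset hWS hc'] using hle
  · rintro ⟨hc, h⟩ c' -
    calc lassoObjective z y s W c = lassoObjective z y s 0 c :=
          lassoObjective_eq_of_support_subset hWS hc
      _ ≤ lassoObjective z y s 0 c₀ := h hc₀
      _ = s * ‖residual z S y‖ ^ 2 := by rw [← lassoObjective_eq_of_support_subset hWS hc₀, hmin]
      _ ≤ lassoObjective z y s W c' := residual_le_lassoObjective hs hWS hW c'

end Lasso

section SubGaussian

variable {Ω : Type*} [MeasurableSpace Ω] {μ : Measure Ω} {Y : Ω → ℝ} {c c' : ℝ≥0}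

lemma hasSubgaussianMGF_of_le (h : HasSubgaussianMGF Y c μ) (hc : c ≤ c') :
    HasSubgaussianMGF Y c' μ where
  integrable_exp_mul := h.integrable_exp_mul
  mgf_le t := (h.mgf_le t).trans (by gcongr)

lemma hasSubgaussianMGF_of_hasLaw_gaussianReal (h : HasLaw Y (gaussianReal 0 c) μ) :
    HasSubgaussianMGF Y c μ where
  integrable_exp_mul t := by
    have hexp := integrable_exp_mul_gaussianReal (μ := 0) (v := c) t
    rw [← h.map_eq] at hexp
    exact hexp.comp_aemeasurable h.aemeasurable
  mgf_le t := by simp [mgf_gaussianReal h.map_eq]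

lemma measureReal_le_abs_le (h : HasSubgaussianMGF Y c μ) {t : ℝ} (ht : 0 ≤ t) :
    μ.real {ω | t ≤ |Y ω|} ≤ 2 * Real.exp (-t ^ 2 / (2 * c)) := by
  have hsplit : {ω | t ≤ |Y ω|} = {ω | t ≤ Y ω} ∪ {ω | t ≤ (-Y) ω} := by
    ext ω
    simp [le_abs]
  calc μ.real {ω | t ≤ |Y ω|} ≤ μ.real {ω | t ≤ Y ω} + μ.real {ω | t ≤ (-Y) ω} :=
        hsplit ▸ measureReal_union_le _ _
    _ ≤ Real.exp (-t ^ 2 / (2 * c)) + Real.exp (-t ^ 2 / (2 * c)) :=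
        add_le_add (h.measure_ge_le ht) (h.neg.measure_ge_le ht)
    _ = 2 * Real.exp (-t ^ 2 / (2 * c)) := (two_mul _).symm

lemma hasSubgaussianMGF_inner {O : Type*} [Fintype O] {e : O → Ω → ℝ} (hind : iIndepFun e μ)
    (hsub : ∀ o, HasSubgaussianMGF (e o) c μ) (u : EuclideanSpace ℝ O) :
    HasSubgaussianMGF (fun ω => ⟪u, WithLp.toLp 2 fun o => e o ω⟫) (‖u‖₊ ^ 2 * c) μ := by
  have hind' : iIndepFun (fun o ω => u o * e o ω) μ :=
    hind.comp (fun o x => u o * x) fun _ => by fun_prop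
  have hsum := HasSubgaussianMGF.sum_of_iIndepFun hind' (s := univ)
    fun o _ => (hsub o).const_mul (u o)
  convert hsum using 1
  · ext ω
    simp [PiLp.inner_apply, mul_comm]
  · refine NNReal.coe_injective ?_
    push_cast
    change ‖u‖ ^ 2 * (c : ℝ) = ∑ o, u o ^ 2 * (c : ℝ)
    simp only [← sum_mul, EuclideanSpace.norm_sq_eq, Real.norm_eq_abs, sq_abs]

lemma lintegral_exp_mul_sq_gaussianReal {b : ℝ} (hb : b < 1 / 2) :
    ∫⁻ g, ENNReal.ofReal (Real.exp (b * g ^ 2)) ∂(gaussianReal 0 1) =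
      ENNReal.ofReal (√(1 - 2 * b))⁻¹ := by
  have hv : 0 < 1 - 2 * b := by linarith
  set v : ℝ≥0 := (1 - 2 * b)⁻¹.toNNReal with hv_def
  have hv_coe : (v : ℝ) = (1 - 2 * b)⁻¹ := Real.coe_toNNReal _ (by positivity)
  have hv_ne : v ≠ 0 := by simpa [hv_def] using hv
  have htilt : ∀ g : ℝ, gaussianPDF 0 1 g * ENNReal.ofReal (Real.exp (b * g ^ 2)) =
      ENNReal.ofReal (√(1 - 2 * b))⁻¹ * gaussianPDF 0 v g := fun g => by
    simp only [gaussianPDF, gaussianPDFReal, hv_coe]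
    rw [← ENNReal.ofReal_mul (by positivity), ← ENNReal.ofReal_mul (by positivity), mul_assoc,
      ← Real.exp_add, ← mul_assoc, ← mul_inv, ← Real.sqrt_mul hv.le]
    congr 3
    · field_simp
      simp
    · field_simp
      push_cast
      ring
  rw [gaussianReal_of_var_ne_zero 0 one_ne_zero,
    lintegral_withDensity_eq_lintegral_mul _ (measurable_gaussianPDF 0 1) (by fun_prop)]
  simp only [Pi.mul_apply, htilt]
  rw [lintegral_const_mul _ (measurable_gaussianPDF 0 v), lintegral_gaussianPDF_eq_one 0 hv_ne,
    mul_one]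

lemma lintegral_exp_mul_gaussianReal (t : ℝ) :
    ∫⁻ g, ENNReal.ofReal (Real.exp (t * g)) ∂(gaussianReal 0 1) =
      ENNReal.ofReal (Real.exp (t ^ 2 / 2)) := by
  rw [← ofReal_integral_eq_lintegral_ofReal (integrable_exp_mul_gaussianReal _)
    (ae_of_all _ fun _ => (Real.exp_pos _).le)]
  simpa [mgf] using congrArg ENNReal.ofReal (congrFun (mgf_id_gaussianReal (μ := 0) (v := 1)) t)

lemma lintegral_exp_mul_le (h : HasSubgaussianMGF Y c μ) (t : ℝ) :
    ∫⁻ ω, ENNReal.ofReal (Real.exp (t * Y ω)) ∂μ ≤ ENNReal.ofReal (Real.exp (c * t ^ 2 / 2)) := by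
  rw [← ofReal_integral_eq_lintegral_ofReal (h.integrable_exp_mul t)
    (ae_of_all _ fun _ => (Real.exp_pos _).le)]
  exact ENNReal.ofReal_le_ofReal (h.mgf_le t)

-- `exp (s x²)` is the moment generating function of a standard Gaussian `g` at `√(2 s) x`, which
-- turns the square into a linear form in `Y`.
lemma lintegral_exp_mul_sq_le [SFinite μ] (h : HasSubgaussianMGF Y c μ) {s : ℝ} (hs : 0 ≤ s)
    (hcs : 2 * c * s < 1) :
    ∫⁻ ω, ENNReal.ofReal (Real.exp (s * Y ω ^ 2)) ∂μ ≤
      ENNReal.ofReal (√(1 - 2 * c * s))⁻¹ := by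
  have hY := h.aemeasurable
  have hsq : √(2 * s) ^ 2 = 2 * s := Real.sq_sqrt (by positivity)
  calc ∫⁻ ω, ENNReal.ofReal (Real.exp (s * Y ω ^ 2)) ∂μ
      = ∫⁻ ω, ∫⁻ g, ENNReal.ofReal (Real.exp (√(2 * s) * Y ω * g)) ∂(gaussianReal 0 1) ∂μ := by
        refine lintegral_congr fun ω => ?_
        rw [lintegral_exp_mul_gaussianReal, mul_pow, hsq]
        ring_nf
    _ = ∫⁻ g, ∫⁻ ω, ENNReal.ofReal (Real.exp (√(2 * s) * g * Y ω)) ∂μ ∂(gaussianReal 0 1) := by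
        rw [lintegral_lintegral_swap]
        · simp only [mul_right_comm]
        · exact (ENNReal.measurable_ofReal.comp Real.measurable_exp).comp_aemeasurable
            ((hY.comp_fst.const_mul _).mul measurable_snd.aemeasurable)
    _ ≤ ∫⁻ g, ENNReal.ofReal (Real.exp (c * s * g ^ 2)) ∂(gaussianReal 0 1) := by
        refine lintegral_mono fun g => (lintegral_exp_mul_le h _).trans_eq ?_
        rw [mul_pow, hsq]
        ring_nf
    _ = ENNReal.ofReal (√(1 - 2 * c * s))⁻¹ := by
        rw [lintegral_exp_mul_sq_gaussianReal (by linarith)]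
        ring_nf

lemma integrable_exp_mul_sq [SFinite μ] (h : HasSubgaussianMGF Y c μ) {s : ℝ} (hs : 0 ≤ s)
    (hcs : 2 * c * s < 1) : Integrable (fun ω => Real.exp (s * Y ω ^ 2)) μ := by
  have hY := h.aemeasurable
  refine ⟨by fun_prop, ?_⟩
  rw [hasFiniteIntegral_iff_ofReal (ae_of_all _ fun _ => (Real.exp_pos _).le)]
  exact (lintegral_exp_mul_sq_le h hs hcs).trans_lt ENNReal.ofReal_lt_top

lemma mgf_sq_le [SFinite μ] (h : HasSubgaussianMGF Y c μ) {s : ℝ} (hs : 0 ≤ s)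
    (hcs : 2 * c * s < 1) : mgf (fun ω => Y ω ^ 2) μ s ≤ (√(1 - 2 * c * s))⁻¹ := by
  rw [mgf, ← ENNReal.ofReal_le_ofReal_iff (by positivity),
    ofReal_integral_eq_lintegral_ofReal (integrable_exp_mul_sq h hs hcs)
      (ae_of_all _ fun _ => (Real.exp_pos _).le)]
  exact lintegral_exp_mul_sq_le h hs hcs

lemma measureReal_le_sum_sq_le [IsProbabilityMeasure μ] {O : Type*} {Z : O → Ω → ℝ}
    (hZ : ∀ o, Measurable (Z o)) (hind : iIndepFun Z μ) (hc : 0 < c)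
    (hsub : ∀ o, HasSubgaussianMGF (Z o) c μ) (T : Finset O) (r : ℝ) :
    μ.real {ω | 4 * c * (1 + r) * #T ≤ ∑ o ∈ T, Z o ω ^ 2} ≤ Real.exp (-(r * #T)) := by
  have hs : 0 ≤ 1 / (4 * (c : ℝ)) := by positivity
  have hcs : 2 * c * (1 / (4 * (c : ℝ))) = 1 / 2 := by field_simp; norm_num
  have hind' : iIndepFun (fun o ω => Z o ω ^ 2) μ :=
    hind.comp (fun _ x => x ^ 2) fun _ => by fun_prop
  have hmeas : ∀ o, Measurable fun ω => Z o ω ^ 2 := fun o => (hZ o).pow_const 2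
  have hmgf : ∀ o, mgf (fun ω => Z o ω ^ 2) μ (1 / (4 * (c : ℝ))) ≤ Real.exp 1 := fun o => by
    refine (mgf_sq_le (hsub o) hs (by rw [hcs]; norm_num)).trans ?_
    rw [hcs, ← Real.sqrt_inv, Real.sqrt_le_left (Real.exp_pos 1).le]
    nlinarith [Real.add_one_le_exp 1]
  have hchernoff := measure_ge_le_exp_mul_mgf (4 * c * (1 + r) * #T) hs
    (hind'.integrable_exp_mul_sum (s := T) hmeas fun o _ =>
      integrable_exp_mul_sq (hsub o) hs (by rw [hcs]; norm_num))
  simp only [Finset.sum_apply] at hchernoff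
  refine hchernoff.trans ?_
  rw [hind'.mgf_sum hmeas]
  calc Real.exp (-(1 / (4 * c)) * (4 * c * (1 + r) * #T)) * ∏ o ∈ T, mgf (fun ω => Z o ω ^ 2) μ _
      ≤ Real.exp (-(1 / (4 * c)) * (4 * c * (1 + r) * #T)) * ∏ _o ∈ T, Real.exp 1 := by
        gcongr with o
        · exact fun _ _ => mgf_nonneg
        · exact hmgf o
    _ = Real.exp (-(r * #T)) := by
        rw [prod_const, ← Real.exp_nat_mul, ← Real.exp_add]
        congr 1
        field_simp
        ring

end SubGaussian

section RandomDesign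

variable {Ω : Type*} [MeasurableSpace Ω] {μ : Measure Ω} [IsProbabilityMeasure μ]

lemma measureReal_prodMk_le_of_indepFun {α β : Type*} [MeasurableSpace α] [MeasurableSpace β]
    {f : Ω → α} {g : Ω → β} (hf : Measurable f) (hg : Measurable g)
    (hfg : IndepFun f g μ) {A : Set (α × β)} (hA : MeasurableSet A) {b : ℝ} (hb : 0 ≤ b)
    (h : ∀ x, μ.real {ω | (f ω, x) ∈ A} ≤ b) : μ.real {ω | (f ω, g ω) ∈ A} ≤ b := by
  have := Measure.isProbabilityMeasure_map (μ := μ) hf.aemeasurable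
  have := Measure.isProbabilityMeasure_map (μ := μ) hg.aemeasurable
  refine ENNReal.toReal_le_of_le_ofReal hb ?_
  change μ ((fun ω => (f ω, g ω)) ⁻¹' A) ≤ _
  rw [← Measure.map_apply (hf.prodMk hg) hA,
    (indepFun_iff_map_prod_eq_prod_map_map hf.aemeasurable hg.aemeasurable).1 hfg,
    Measure.prod_apply_symm hA]
  calc ∫⁻ x, (μ.map f) ((fun e => (e, x)) ⁻¹' A) ∂(μ.map g)
      ≤ ∫⁻ _, ENNReal.ofReal b ∂(μ.map g) := by
        refine lintegral_mono fun x => ?_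
        rw [Measure.map_apply hf (measurable_prodMk_right hA)]
        exact (ENNReal.le_ofReal_iff_toReal_le (measure_ne_top _ _) hb).2 (h x)
    _ = ENNReal.ofReal b := by simp

variable {J O : Type*} [Finite J] [Fintype O] {e : O → Ω → ℝ} {z : Ω → J → EuclideanSpace ℝ O}
  {c : ℝ≥0}

lemma measureReal_le_abs_inner_residual_le (he : ∀ o, Measurable (e o)) (hind : iIndepFun e μ)
    (hsub : ∀ o, HasSubgaussianMGF (e o) c μ) (hz : Measurable z)
    (hez : IndepFun (fun ω o => e o ω) z μ) (S : Set J) (j : J) (B : ℝ≥0) {t : ℝ} (ht : 0 ≤ t) :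
    μ.real {ω | t ≤ |⟪residual (z ω) S (z ω j), WithLp.toLp 2 fun o => e o ω⟫|} ≤
      μ.real {ω | B ≤ ‖z ω j‖ ^ 2} + 2 * Real.exp (-t ^ 2 / (2 * (B * c))) := by
  set A : Set ((O → ℝ) × (J → EuclideanSpace ℝ O)) :=
    {q | t ≤ |⟪residual q.2 S (q.2 j), WithLp.toLp 2 q.1⟫| ∧ ‖q.2 j‖ ^ 2 ≤ B}
  have hcol : Measurable fun q : (O → ℝ) × (J → EuclideanSpace ℝ O) => q.2 j := by fun_prop
  have htoLp : Measurable fun q : (O → ℝ) × (J → EuclideanSpace ℝ O) => WithLp.toLp 2 q.1 := by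
    fun_prop
  have hA : MeasurableSet A :=
    (measurableSet_le measurable_const
      (measurable_inner_residual measurable_snd hcol htoLp S).abs).inter
      (measurableSet_le (hcol.norm.pow_const 2) measurable_const)
  have hnoise : μ.real {ω | ((fun o => e o ω), z ω) ∈ A} ≤
      2 * Real.exp (-t ^ 2 / (2 * (B * c))) := by
    refine measureReal_prodMk_le_of_indepFun (measurable_pi_lambda _ he) hz hez hA (by positivity)
      fun x => ?_
    by_cases hx : ‖x j‖ ^ 2 ≤ B
    · have hle : ‖residual x S (x j)‖₊ ^ 2 ≤ B := by
        have := pow_le_pow_left₀ (norm_nonneg _) (norm_residual_le x S (x j)) 2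
        exact_mod_cast this.trans hx
      have hY := hasSubgaussianMGF_of_le (hasSubgaussianMGF_inner hind hsub (residual x S (x j)))
        (mul_le_mul_left hle c)
      refine (measureReal_mono fun ω hω => ?_).trans (measureReal_le_abs_le hY ht)
      exact hω.1
    · have hempty : {ω | ((fun o => e o ω), x) ∈ A} = ∅ :=
        Set.eq_empty_of_forall_notMem fun ω hω => hx hω.2
      rw [hempty, measureReal_empty]
      positivity
  refine (measureReal_mono fun ω hω => ?_).trans
    ((measureReal_union_le _ _).trans (add_le_add_right hnoise _))
  rcases le_total (B : ℝ) (‖z ω j‖ ^ 2) with hlarge | hsmall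
  · exact Or.inl hlarge
  · exact Or.inr ⟨hω, hsmall⟩

end RandomDesign

section AdaptedWeights

/-- The weights `w` leave the nonzero entries of the parameter `θ` unpenalised and charge its zero
entries at least `a₁`. Folded-concave weights at accurate initial values have this property. -/
def IsAdapted {J : Type*} (a₁ : ℝ) (θ w : J → ℝ) : Prop :=
  ∀ j, (θ j ≠ 0 → w j = 0) ∧ (θ j = 0 → a₁ ≤ w j)

variable {R : ℝ → ℝ → ℝ} {a a₁ a₂ lam x b : ℝ}

lemma weight_eq_zero (hR : IsFoldedConcave R a a₁ a₂) (ha : a₂ < a) (hlam : 0 < lam)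
    (hb : 3 * a / 2 * lam ≤ |b|) (hx : |x - b| ≤ a₂ / 2 * lam) : weight R lam x = 0 := by
  have htri : |b| - |x| ≤ |x - b| := abs_sub_comm x b ▸ abs_sub_abs_le_abs_sub b x
  rw [weight, hR.deriv_eq_zero lam hlam _ (by nlinarith), mul_zero]

lemma le_weight (hR : IsFoldedConcave R a a₁ a₂) (hlam : 0 < lam) (hx : |x| ≤ a₂ / 2 * lam) :
    a₁ ≤ weight R lam x := by
  have hderiv := hR.deriv_ge lam hlam |x| (abs_nonneg x) (by linarith [abs_nonneg x])
  rwa [weight, inv_mul_eq_div, le_div_iff₀ hlam]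

lemma isAdapted_weight {J : Type*} [Fintype J] {θ θ₀ : J → ℝ} {h : ℝ}
    (hR : IsFoldedConcave R a a₁ a₂) (ha : a₂ < a) (hlam : 0 < lam) (hh : 3 * a / 2 * lam ≤ h)
    (hθ : ∀ j, θ j ≠ 0 → h ≤ |θ j|) (hθ₀ : ‖θ₀ - θ‖ ≤ a₂ / 2 * lam) :
    IsAdapted a₁ θ fun j => weight R lam (θ₀ j) := fun j => by
  have hj : |θ₀ j - θ j| ≤ a₂ / 2 * lam := (norm_le_pi_norm (θ₀ - θ) j).trans hθ₀
  refine ⟨fun hne => weight_eq_zero hR ha hlam (hh.trans (hθ j hne)) hj, fun hzero => ?_⟩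
  rw [hzero, sub_zero] at hj
  exact le_weight hR hlam hj

end AdaptedWeights

section Stacked

variable {K nT nS p : ℕ}

/-- The index set of all coefficients: `p` entries of `β` and `p` entries of each contrast. -/
abbrev Coef (K p : ℕ) : Type := Fin p ⊕ (Fin K × Fin p)

/-- The parameters `(β, (δ⁽ᵏ⁾)ₖ)` as a single coefficient vector, which turns the fused Lasso into a
plain weighted Lasso. -/
def stack : (Fin p → ℝ) × (Fin K → Fin p → ℝ) ≃ (Coef K p → ℝ) where
  toFun θ := Sum.elim θ.1 fun q => θ.2 q.1 q.2
  invFun c := (fun j => c (.inl j), fun k j => c (.inr (k, j)))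
  left_inv _ := rfl
  right_inv c := by ext (_ | _) <;> rfl

/-- The tuning parameter of each coefficient: `lam0` for `β`, `lam1` for the contrasts. -/
def tuning (lam0 lam1 : ℝ) : Coef K p → ℝ := Sum.elim (fun _ => lam0) fun _ => lam1

/-- The observations in which a coefficient is active: all of them for `β`, and those of task `k`
for `δ⁽ᵏ⁾`. -/
def activeRows (nT nS : ℕ) : Coef K p → Finset (Obs K nT nS) :=
  Sum.elim (fun _ => univ) fun q => univ.filter fun o => o.1 = q.1.succ

/-- The covariate that a coefficient multiplies. -/
def covariate : Coef K p → Fin p := Sum.elim id Prod.snd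

/-- The columns of the stacked design matrix. -/
noncomputable def column (x : Obs K nT nS → Fin p → ℝ) (j : Coef K p) :
    EuclideanSpace ℝ (Obs K nT nS) :=
  WithLp.toLp 2 fun o => if o ∈ activeRows nT nS j then x o (covariate j) else 0

@[simp]
lemma stack_inl (θ : (Fin p → ℝ) × (Fin K → Fin p → ℝ)) (j : Fin p) :
    stack θ (.inl j) = θ.1 j := rfl

@[simp]
lemma stack_inr (θ : (Fin p → ℝ) × (Fin K → Fin p → ℝ)) (q : Fin K × Fin p) :
    stack θ (.inr q) = θ.2 q.1 q.2 := rfl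

lemma isAdapted_stack {a₁ : ℝ} {β w0 : Fin p → ℝ} {δ w : Fin K → Fin p → ℝ}
    (h0 : IsAdapted a₁ β w0) (h : ∀ k, IsAdapted a₁ (δ k) (w k)) :
    IsAdapted a₁ (stack (β, δ)) (stack (w0, w)) := by
  rintro (j | ⟨k, j⟩)
  · exact h0 j
  · exact h k j

lemma tuning_nonneg {lam0 lam1 : ℝ} (hlam0 : 0 ≤ lam0) (hlam1 : 0 ≤ lam1) (j : Coef K p) :
    0 ≤ tuning lam0 lam1 j := by
  cases j <;> assumption

lemma card_activeRows_inl (j : Fin p) :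
    #(activeRows nT nS (.inl j : Coef K p)) = totalSize K nT nS := by
  simp only [activeRows, Sum.elim_inl, card_univ, Fintype.card_sigma, Fintype.card_fin]
  simp [totalSize, taskSize, Fin.sum_univ_succ, add_comm]

lemma card_activeRows_inr (q : Fin K × Fin p) :
    #(activeRows nT nS (.inr q : Coef K p)) = nS := by
  have hmap : (univ.filter fun o : Obs K nT nS => o.1 = q.1.succ) =
      univ.map (Function.Embedding.sigmaMk q.1.succ) := by
    ext ⟨k, i⟩
    simp only [mem_filter, mem_univ, true_and, mem_map, Function.Embedding.sigmaMk_apply]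
    constructor
    · rintro rfl
      exact ⟨i, rfl⟩
    · rintro ⟨i', h⟩
      exact (congrArg Sigma.fst h).symm
  simp only [activeRows, Sum.elim_inr, hmap, card_map, card_univ, Fintype.card_fin]
  simp [taskSize]

lemma norm_column_sq (x : Obs K nT nS → Fin p → ℝ) (j : Coef K p) :
    ‖column x j‖ ^ 2 = ∑ o ∈ activeRows nT nS j, x o (covariate j) ^ 2 := by
  simp [EuclideanSpace.norm_sq_eq, column]

lemma measurable_column :
    Measurable fun x : Obs K nT nS → Fin p → ℝ => (column x : Coef K p → _) := by
  refine measurable_pi_lambda _ fun j => (WithLp.measurable_toLp 2 _).comp ?_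
  refine measurable_pi_lambda _ fun o => ?_
  split_ifs <;> fun_prop

lemma sum_stack_smul_column (x : Obs K nT nS → Fin p → ℝ)
    (θ : (Fin p → ℝ) × (Fin K → Fin p → ℝ)) :
    ∑ j, stack θ j • column x j = WithLp.toLp 2 fun o => x o ⬝ᵥ (θ.1 + extend θ.2 o.1) := by
  ext ⟨k, i⟩
  simp only [WithLp.ofLp_sum, WithLp.ofLp_smul, Finset.sum_apply, Pi.smul_apply, smul_eq_mul]
  simp only [Fintype.sum_sum_type, Fintype.sum_prod_type, column, stack_inl, stack_inr, activeRows,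
    covariate, Sum.elim_inl, Sum.elim_inr, mem_univ, if_true, id, mem_filter, true_and,
    dotProduct, Pi.add_apply, mul_add, sum_add_distrib]
  congr 1
  · exact sum_congr rfl fun _ _ => mul_comm _ _
  · cases k using Fin.cases with
    | zero => simp [extend, (Fin.succ_ne_zero _).symm]
    | succ k =>
      simp only [extend, Fin.cons_succ, Fin.succ_inj, mul_ite, mul_zero]
      rw [sum_eq_single k (fun l _ hl => by simp [hl.symm]) (by simp)]
      simp [mul_comm]

lemma loss_eq_lassoObjective (x : Obs K nT nS → Fin p → ℝ) (y : Obs K nT nS → ℝ)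
    (θ : (Fin p → ℝ) × (Fin K → Fin p → ℝ)) :
    loss x y θ =
      lassoObjective (column x) (WithLp.toLp 2 y) (1 / totalSize K nT nS) 0 (stack θ) := by
  rw [lassoObjective, sum_stack_smul_column, EuclideanSpace.norm_sq_eq, Fintype.sum_sigma, loss]
  simp

lemma objective_eq_lassoObjective (x : Obs K nT nS → Fin p → ℝ) (y : Obs K nT nS → ℝ)
    (lam0 lam1 : ℝ) (w0 : Fin p → ℝ) (w : Fin K → Fin p → ℝ)
    (θ : (Fin p → ℝ) × (Fin K → Fin p → ℝ)) :
    objective x y lam0 lam1 w0 w θ =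
      lassoObjective (column x) (WithLp.toLp 2 y) (1 / totalSize K nT nS)
        (tuning lam0 lam1 * stack (w0, w)) (stack θ) := by
  rw [objective, loss_eq_lassoObjective, add_assoc]
  simp only [lassoObjective, tuning, Pi.mul_apply, Fintype.sum_sum_type, Fintype.sum_prod_type,
    stack_inl, stack_inr, Sum.elim_inl, Sum.elim_inr, mul_sum, mul_assoc, Pi.zero_apply, zero_mul,
    sum_const_zero, add_zero]

lemma mem_oracleFeasible_iff {β : Fin p → ℝ} {δ : Fin K → Fin p → ℝ}
    {θ : (Fin p → ℝ) × (Fin K → Fin p → ℝ)} :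
    θ ∈ oracleFeasible β δ ↔ Function.support (stack θ) ⊆ Function.support (stack (β, δ)) := by
  rw [Function.support_subset_iff']
  simp [oracleFeasible]

lemma mem_lassoSolutions_iff {x : Obs K nT nS → Fin p → ℝ} {y : Obs K nT nS → ℝ} {lam0 lam1 : ℝ}
    {w0 : Fin p → ℝ} {w : Fin K → Fin p → ℝ} {θ : (Fin p → ℝ) × (Fin K → Fin p → ℝ)} :
    θ ∈ lassoSolutions x y lam0 lam1 w0 w ↔
      IsMinOn (lassoObjective (column x) (WithLp.toLp 2 y) (1 / totalSize K nT nS)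
        (tuning lam0 lam1 * stack (w0, w))) Set.univ (stack θ) := by
  simp only [lassoSolutions, Set.mem_ofPred_eq, objective_eq_lassoObjective, isMinOn_univ_iff,
    stack.surjective.forall]

lemma mem_oracleSolutions_iff {x : Obs K nT nS → Fin p → ℝ} {y : Obs K nT nS → ℝ}
    {β : Fin p → ℝ} {δ : Fin K → Fin p → ℝ} {θ : (Fin p → ℝ) × (Fin K → Fin p → ℝ)} :
    θ ∈ oracleSolutions x y β δ ↔
      Function.support (stack θ) ⊆ Function.support (stack (β, δ)) ∧
        IsMinOn (lassoObjective (column x) (WithLp.toLp 2 y) (1 / totalSize K nT nS) 0)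
          {c | Function.support c ⊆ Function.support (stack (β, δ))} (stack θ) := by
  simp only [oracleSolutions, Set.mem_ofPred_eq, loss_eq_lassoObjective, mem_oracleFeasible_iff,
    isMinOn_iff, stack.surjective.forall]

/-- The correlation of column `j` with the noise `e` after regression on the columns in `S`. -/
noncomputable def correlation (x : Obs K nT nS → Fin p → ℝ) (e : Obs K nT nS → ℝ)
    (S : Set (Coef K p)) (j : Coef K p) : ℝ :=
  ⟪residual (column x) S (column x j), WithLp.toLp 2 e⟫

lemma inner_column_residual_response (x : Obs K nT nS → Fin p → ℝ) (e : Obs K nT nS → ℝ)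
    (β : Fin p → ℝ) (δ : Fin K → Fin p → ℝ) (j : Coef K p) :
    ⟪column x j, residual (column x) (Function.support (stack (β, δ)))
      (WithLp.toLp 2 (response x e β δ))⟫ =
      correlation x e (Function.support (stack (β, δ))) j := by
  have hsplit : WithLp.toLp 2 (response x e β δ) =
      ∑ j, stack (β, δ) j • column x j + WithLp.toLp 2 e := by
    rw [sum_stack_smul_column]
    rfl
  rw [correlation, inner_residual_left, hsplit, map_add,
    residual_eq_zero (mem_columnSpan_iff.2 ⟨_, subset_rfl, rfl⟩), zero_add]

theorem lassoSolutions_eq_oracleSolutions {a₁ lam0 lam1 : ℝ} (hlam0 : 0 ≤ lam0) (hlam1 : 0 ≤ lam1)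
    {β w0 : Fin p → ℝ} {δ w : Fin K → Fin p → ℝ} {x : Obs K nT nS → Fin p → ℝ}
    {e : Obs K nT nS → ℝ} (hw : IsAdapted a₁ (stack (β, δ)) (stack (w0, w)))
    (hcorr : ∀ j, |correlation x e (Function.support (stack (β, δ))) j| <
      totalSize K nT nS / 2 * (a₁ * tuning lam0 lam1 j)) :
    (lassoSolutions x (response x e β δ) lam0 lam1 w0 w).Nonempty ∧
      lassoSolutions x (response x e β δ) lam0 lam1 w0 w =
        oracleSolutions x (response x e β δ) β δ := by
  have hs : (0 : ℝ) ≤ 1 / totalSize K nT nS := by positivity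
  have hWS : ∀ j ∈ Function.support (stack (β, δ)),
      (tuning lam0 lam1 * stack (w0, w) : Coef K p → ℝ) j = 0 := fun j hj => by
    rw [Pi.mul_apply, (hw j).1 hj, mul_zero]
  have hW : ∀ j ∉ Function.support (stack (β, δ)),
      |2 * (1 / totalSize K nT nS) * ⟪column x j, residual (column x)
        (Function.support (stack (β, δ))) (WithLp.toLp 2 (response x e β δ))⟫| <
        (tuning lam0 lam1 * stack (w0, w) : Coef K p → ℝ) j := fun j hj => by
    have hN : (0 : ℝ) < totalSize K nT nS := (Nat.cast_nonneg _).lt_of_ne' fun hN =>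
      (abs_nonneg _).not_gt ((hcorr j).trans_eq (by rw [hN]; ring))
    rw [inner_column_residual_response, abs_mul, abs_of_nonneg (by positivity)]
    calc 2 * (1 / (totalSize K nT nS : ℝ)) * |correlation x e _ j|
        < 2 * (1 / totalSize K nT nS) * (totalSize K nT nS / 2 * (a₁ * tuning lam0 lam1 j)) :=
          mul_lt_mul_of_pos_left (hcorr j) (by positivity)
      _ = tuning lam0 lam1 j * a₁ := by field_simp
      _ ≤ tuning lam0 lam1 j * stack (w0, w) j :=
          mul_le_mul_of_nonneg_left ((hw j).2 (Function.notMem_support.1 hj))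
            (tuning_nonneg hlam0 hlam1 j)
  obtain ⟨c, hc⟩ := exists_isMinOn_lassoObjective hs hWS hW
  refine ⟨⟨stack.symm c, ?_⟩, Set.ext fun θ => ?_⟩
  · rwa [mem_lassoSolutions_iff, Equiv.apply_symm_apply]
  · rw [mem_lassoSolutions_iff, mem_oracleSolutions_iff, isMinOn_lassoObjective_iff hs hWS hW]

end Stacked

section Event

variable {Ω : Type*} [MeasurableSpace Ω] {μ : Measure Ω}

lemma le_measureReal_forall_lt [IsProbabilityMeasure μ] {ι : Type*} [Fintype ι] {f : ι → Ω → ℝ}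
    (hf : ∀ i, Measurable (f i)) {t : ι → ℝ} {b : ℝ} (h : ∀ i, μ.real {ω | t i ≤ f i ω} ≤ b) :
    1 - Fintype.card ι * b ≤ μ.real {ω | ∀ i, f i ω < t i} := by
  have hcompl : {ω | ∀ i, f i ω < t i} = (⋃ i, {ω | t i ≤ f i ω})ᶜ := by
    ext ω
    simp
  have hunion : μ.real (⋃ i, {ω | t i ≤ f i ω}) ≤ Fintype.card ι * b :=
    calc μ.real (⋃ i, {ω | t i ≤ f i ω}) ≤ ∑ i, μ.real {ω | t i ≤ f i ω} :=
          measureReal_iUnion_fintype_le _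
      _ ≤ ∑ _i : ι, b := sum_le_sum fun i _ => h i
      _ = Fintype.card ι * b := by simp
  rw [hcompl, probReal_compl_eq_one_sub
    (MeasurableSet.iUnion fun i => measurableSet_le measurable_const (hf i))]
  linarith

/-- The probabilistic content of the design and noise assumptions: independent rows whose entries
are sub-Gaussian, and an independent noise vector with independent sub-Gaussian entries. -/
structure IsSubGaussianModel {K nT nS p : ℕ} (μ : Measure Ω) (X : Obs K nT nS → Ω → Fin p → ℝ)
    (eps : Obs K nT nS → Ω → ℝ) (κ c : ℝ≥0) : Prop where
  measurable_design : ∀ o, Measurable (X o)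
  indep_rows : iIndepFun X μ
  subGaussian_design : ∀ o j, HasSubgaussianMGF (fun ω => X o ω j) κ μ
  measurable_noise : ∀ o, Measurable (eps o)
  indep_noise : iIndepFun eps μ
  subGaussian_noise : ∀ o, HasSubgaussianMGF (eps o) c μ
  indep_design : IndepFun (fun ω o => eps o ω) (fun ω o => X o ω) μ

variable {K nT nS p : ℕ} {X : Obs K nT nS → Ω → Fin p → ℝ} {eps : Obs K nT nS → Ω → ℝ}
  {κ c : ℝ≥0}

lemma hasSubgaussianMGF_apply {V : Ω → Fin p → ℝ} (h : IsSubGaussianVector V κ μ) (j : Fin p) :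
    HasSubgaussianMGF (fun ω => V ω j) κ μ := by
  simpa using h (Pi.single j 1) (by simp [Pi.single_apply, ite_pow])

lemma isSubGaussianModel_of_assumptions {Sig : Fin (K + 1) → Matrix (Fin p) (Fin p) ℝ}
    {v : Fin (K + 1) → ℝ≥0} {c_X c_eps : ℝ} (hX : DesignAssumption μ X Sig κ c_X)
    (heps : NoiseAssumption μ X eps v c_eps) : IsSubGaussianModel μ X eps κ c_eps.toNNReal where
  measurable_design := hX.measurable
  indep_rows := hX.indep
  subGaussian_design o := hasSubgaussianMGF_apply (hX.subGaussian o)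
  measurable_noise := heps.measurable
  indep_noise := heps.indep
  subGaussian_noise o :=
    hasSubgaussianMGF_of_le (hasSubgaussianMGF_of_hasLaw_gaussianReal (heps.gaussian o))
      (NNReal.le_toNNReal_of_coe_le (heps.variance_le o.1))
  indep_design := heps.indep_design

lemma IsSubGaussianModel.mono {κ' c' : ℝ≥0} (h : IsSubGaussianModel μ X eps κ c) (hκ : κ ≤ κ')
    (hc : c ≤ c') : IsSubGaussianModel μ X eps κ' c' where
  __ := h
  subGaussian_design o j := hasSubgaussianMGF_of_le (h.subGaussian_design o j) hκ
  subGaussian_noise o := hasSubgaussianMGF_of_le (h.subGaussian_noise o) hc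

lemma IsSubGaussianModel.measurable_correlation (h : IsSubGaussianModel μ X eps κ c)
    (S : Set (Coef K p)) (j : Coef K p) :
    Measurable fun ω => correlation (fun o => X o ω) (fun o => eps o ω) S j := by
  have hcol : Measurable fun ω => (column (fun o => X o ω) : Coef K p → _) :=
    measurable_column.comp (measurable_pi_lambda _ h.measurable_design)
  exact measurable_inner_residual hcol ((measurable_pi_apply j).comp hcol)
    ((WithLp.measurable_toLp 2 _).comp (measurable_pi_lambda _ h.measurable_noise)) S

lemma IsSubGaussianModel.measurableSet_correlation_lt (h : IsSubGaussianModel μ X eps κ c)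
    (S : Set (Coef K p)) (t : Coef K p → ℝ) :
    MeasurableSet {ω | ∀ j, |correlation (fun o => X o ω) (fun o => eps o ω) S j| < t j} := by
  rw [Set.ofPred_forall]
  exact MeasurableSet.iInter fun j =>
    measurableSet_lt (h.measurable_correlation S j).abs measurable_const

lemma IsSubGaussianModel.measureReal_le_norm_column_sq [IsProbabilityMeasure μ]
    (h : IsSubGaussianModel μ X eps κ c) (hκ : 0 < κ) (j : Coef K p) (r : ℝ) :
    μ.real {ω | 4 * κ * (1 + r) * #(activeRows nT nS j) ≤ ‖column (fun o => X o ω) j‖ ^ 2} ≤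
      Real.exp (-(r * #(activeRows nT nS j))) := by
  simp only [norm_column_sq]
  exact measureReal_le_sum_sq_le (fun o => (measurable_pi_apply _).comp (h.measurable_design o))
    (h.indep_rows.comp (fun _ x => x (covariate j)) fun _ => measurable_pi_apply _) hκ
    (fun o => h.subGaussian_design o _) _ r

lemma IsSubGaussianModel.measureReal_le_abs_correlation_le [IsProbabilityMeasure μ]
    (h : IsSubGaussianModel μ X eps κ c) (hκ : 0 < κ) (hc : 0 < c) (S : Set (Coef K p))
    (j : Coef K p) {r : ℝ≥0} {q t : ℝ} (hq : 0 < q) (hr : q ≤ r * #(activeRows nT nS j))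
    (ht : 0 ≤ t) (hqt : 8 * κ * c * (1 + r) * #(activeRows nT nS j) * q ≤ t ^ 2) :
    μ.real {ω | t ≤ |correlation (fun o => X o ω) (fun o => eps o ω) S j|} ≤
      3 * Real.exp (-q) := by
  have hn : (0 : ℝ) < #(activeRows nT nS j) := pos_of_mul_pos_right (hq.trans_le hr) r.2
  set B : ℝ≥0 := 4 * κ * (1 + r) * #(activeRows nT nS j) with hB
  have hB_coe : (B : ℝ) = 4 * κ * (1 + r) * #(activeRows nT nS j) := by simp [hB]
  have hcol : Measurable fun ω => (column (fun o => X o ω) : Coef K p → _) :=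
    measurable_column.comp (measurable_pi_lambda _ h.measurable_design)
  have hdesign : μ.real {ω | (B : ℝ) ≤ ‖column (fun o => X o ω) j‖ ^ 2} ≤ Real.exp (-q) := by
    rw [hB_coe]
    exact (h.measureReal_le_norm_column_sq hκ j r).trans (by gcongr)
  have hnoise : Real.exp (-t ^ 2 / (2 * (B * c))) ≤ Real.exp (-q) := by
    rw [Real.exp_le_exp, div_le_iff₀ (by rw [hB_coe]; positivity), hB_coe]
    linarith
  have htail := measureReal_le_abs_inner_residual_le h.measurable_noise h.indep_noise
    h.subGaussian_noise hcol (h.indep_design.comp measurable_id measurable_column) S j B ht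
  calc μ.real {ω | t ≤ |correlation (fun o => X o ω) (fun o => eps o ω) S j|}
      ≤ _ := htail
    _ ≤ Real.exp (-q) + 2 * Real.exp (-q) := by gcongr
    _ = 3 * Real.exp (-q) := by ring

end Event

section Rates

variable {K nT nS p : ℕ}

lemma mul_sqrt_div_self {n : ℝ} (hn : 0 ≤ n) (ℓ : ℝ) : n * √(ℓ / n) = √(n * ℓ) := by
  rcases hn.eq_or_lt with rfl | hpos
  · simp
  · rw [← Real.sqrt_sq hn, ← Real.sqrt_mul (sq_nonneg n), Real.sqrt_sq hn]
    congr 1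
    field_simp

lemma nS_le_totalSize (hK : 1 ≤ K) : nS ≤ totalSize K nT nS :=
  (Nat.le_mul_of_pos_left nS hK).trans (Nat.le_add_right _ _)

lemma nS_le_card_activeRows (hK : 1 ≤ K) (j : Coef K p) : nS ≤ #(activeRows nT nS j) := by
  rcases j with j | q
  · exact (nS_le_totalSize hK).trans_eq (card_activeRows_inl j).symm
  · exact (card_activeRows_inr q).ge

lemma sqrt_card_activeRows_le_tuning {C ℓ lam0 lam1 : ℝ} (hN : 0 < totalSize K nT nS)
    (h0 : C * √(ℓ / totalSize K nT nS) ≤ lam0)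
    (h1 : C * (nS / totalSize K nT nS * √(ℓ / nS)) ≤ lam1) (j : Coef K p) :
    C * √(#(activeRows nT nS j) * ℓ) ≤ totalSize K nT nS * tuning lam0 lam1 j := by
  have hN' : (0 : ℝ) < totalSize K nT nS := Nat.cast_pos.2 hN
  rcases j with j | q
  · rw [card_activeRows_inl, ← mul_sqrt_div_self hN'.le, mul_left_comm]
    exact mul_le_mul_of_nonneg_left h0 hN'.le
  · rw [card_activeRows_inr, ← mul_sqrt_div_self nS.cast_nonneg]
    calc C * (nS * √(ℓ / nS))
        = totalSize K nT nS * (C * (nS / totalSize K nT nS * √(ℓ / nS))) := by field_simp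
      _ ≤ totalSize K nT nS * lam1 := mul_le_mul_of_nonneg_left h1 hN'.le

lemma card_activeRows_mul_le_sq {A a₁ ℓ lam0 lam1 : ℝ} (hA : 0 ≤ A) (ha₁ : 0 < a₁)
    (hN : 0 < totalSize K nT nS)
    (h0 : 2 * √A / a₁ * √(ℓ / totalSize K nT nS) ≤ lam0)
    (h1 : 2 * √A / a₁ * (nS / totalSize K nT nS * √(ℓ / nS)) ≤ lam1) (j : Coef K p) :
    A * (#(activeRows nT nS j) * ℓ) ≤
      (totalSize K nT nS / 2 * (a₁ * tuning lam0 lam1 j)) ^ 2 := by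
  refine (Real.sqrt_le_iff.1 ?_).2
  calc √(A * (#(activeRows nT nS j) * ℓ))
      = a₁ / 2 * (2 * √A / a₁ * √(#(activeRows nT nS j) * ℓ)) := by
        rw [Real.sqrt_mul hA]
        field_simp
    _ ≤ a₁ / 2 * (totalSize K nT nS * tuning lam0 lam1 j) :=
        mul_le_mul_of_nonneg_left (sqrt_card_activeRows_le_tuning hN h0 h1 j) (by positivity)
    _ = totalSize K nT nS / 2 * (a₁ * tuning lam0 lam1 j) := by ring

lemma card_coef_mul_exp_le {M : ℝ} (hK : 1 ≤ K) (hp : 2 ≤ p) (hKp : Real.log K ≤ M * Real.log p) :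
    Fintype.card (Coef K p) * (3 * Real.exp (-((|M| + 5) * Real.log p))) ≤
      Real.exp (-Real.log p) := by
  have hK' : (1 : ℝ) ≤ K := by exact_mod_cast hK
  have hp' : (2 : ℝ) ≤ p := by exact_mod_cast hp
  have hlog : 0 ≤ Real.log p := Real.log_nonneg (by linarith)
  have hpexp : Real.exp (Real.log p) = p := Real.exp_log (by linarith)
  have hKexp : (K : ℝ) ≤ Real.exp (|M| * Real.log p) :=
    (Real.log_le_iff_le_exp (by linarith)).1
      (hKp.trans (mul_le_mul_of_nonneg_right (le_abs_self M) hlog))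
  have hcard : (Fintype.card (Coef K p) : ℝ) * 3 ≤ Real.exp (|M| * Real.log p) * p ^ 4 :=
    calc (Fintype.card (Coef K p) : ℝ) * 3 = (p + K * p) * 3 := by simp
      _ ≤ (K * p + K * p) * 3 := by gcongr; exact le_mul_of_one_le_left (by linarith) hK'
      _ ≤ K * p * 2 ^ 3 := by nlinarith [mul_nonneg (zero_le_one.trans hK') (zero_le_two.trans hp')]
      _ ≤ Real.exp (|M| * Real.log p) * p * p ^ 3 := by gcongr
      _ = Real.exp (|M| * Real.log p) * p ^ 4 := by ring
  calc Fintype.card (Coef K p) * (3 * Real.exp (-((|M| + 5) * Real.log p)))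
      ≤ Real.exp (|M| * Real.log p) * p ^ 4 * Real.exp (-((|M| + 5) * Real.log p)) := by
        rw [← mul_assoc]
        gcongr
    _ = Real.exp (-Real.log p) := by
        nth_rewrite 2 [← hpexp]
        rw [← Real.exp_nat_mul, ← Real.exp_add, ← Real.exp_add]
        congr 1
        push_cast
        ring

end Rates

theorem IsSubGaussianModel.le_measureReal_correlation_lt {K nT nS p : ℕ} {Ω : Type*}
    [MeasurableSpace Ω] {μ : Measure Ω} [IsProbabilityMeasure μ] {X : Obs K nT nS → Ω → Fin p → ℝ}
    {eps : Obs K nT nS → Ω → ℝ} {κ c r : ℝ≥0} {M a₁ lam0 lam1 : ℝ}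
    (h : IsSubGaussianModel μ X eps κ c) (hκ : 0 < κ) (hc : 0 < c) (hK : 1 ≤ K) (hp : 2 ≤ p)
    (hKp : Real.log K ≤ M * Real.log p) (hr : (|M| + 5) * Real.log p ≤ r * nS) (ha₁ : 0 < a₁)
    (hlam0 : 0 ≤ lam0) (hlam1 : 0 ≤ lam1)
    (h0 : 2 * √(8 * κ * c * (1 + r) * (|M| + 5)) / a₁ *
      √(Real.log p / totalSize K nT nS) ≤ lam0)
    (h1 : 2 * √(8 * κ * c * (1 + r) * (|M| + 5)) / a₁ *
      (nS / totalSize K nT nS * √(Real.log p / nS)) ≤ lam1) (S : Set (Coef K p)) :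
    1 - Real.exp (-Real.log p) ≤
      μ.real {ω | ∀ j, |correlation (fun o => X o ω) (fun o => eps o ω) S j| <
        totalSize K nT nS / 2 * (a₁ * tuning lam0 lam1 j)} := by
  have hq : 0 < (|M| + 5) * Real.log p :=
    mul_pos (by positivity) (Real.log_pos (by exact_mod_cast hp))
  have hnS : 0 < nS := Nat.cast_pos.1 (pos_of_mul_pos_right (hq.trans_le hr) r.2)
  have htail : ∀ j, μ.real {ω | totalSize K nT nS / 2 * (a₁ * tuning lam0 lam1 j) ≤
      |correlation (fun o => X o ω) (fun o => eps o ω) S j|} ≤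
        3 * Real.exp (-((|M| + 5) * Real.log p)) := fun j => by
    have hrows : (nS : ℝ) ≤ #(activeRows nT nS j) := by exact_mod_cast nS_le_card_activeRows hK j
    have hsq := card_activeRows_mul_le_sq (by positivity) ha₁
      (hnS.trans_le (nS_le_totalSize hK)) h0 h1 j
    refine h.measureReal_le_abs_correlation_le hκ hc S j hq (hr.trans (by gcongr)) ?_
      (le_of_eq_of_le (by ring) hsq)
    have := tuning_nonneg hlam0 hlam1 j
    positivity
  have hevent := le_measureReal_forall_lt (fun j => (h.measurable_correlation S j).abs) htail
  linarith [card_coef_mul_exp_le hK hp hKp]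

end AdaTrans

open AdaTrans MeasureTheory ProbabilityTheory Finset

theorem theorem2_general (κ c : NNReal) {c_n : ℝ} (hc_n : 0 < c_n) (M : ℝ) {a₁ : ℝ}
    (ha₁ : 0 < a₁) :
    ∃ C₀ > (0 : ℝ), ∃ C₁ > (0 : ℝ), ∃ c₁ > (0 : ℝ),
      ∀ (K nT nS p : ℕ), 1 ≤ K → Real.log K ≤ M * Real.log p → c_n * Real.log p ≤ nS →
      ∀ (Ω : Type*) [MeasurableSpace Ω] (μ : Measure Ω) [IsProbabilityMeasure μ]
        (X : Obs K nT nS → Ω → Fin p → ℝ) (eps : Obs K nT nS → Ω → ℝ),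
        IsSubGaussianModel μ X eps κ c →
      ∀ (lam0 lam1 : ℝ), 0 ≤ lam0 → 0 ≤ lam1 →
        C₀ * √(Real.log p / totalSize K nT nS) ≤ lam0 →
        C₁ * (nS / totalSize K nT nS * √(Real.log p / nS)) ≤ lam1 →
      ∀ (β : Fin p → ℝ) (δ : Fin K → Fin p → ℝ),
      ∃ E : Set Ω, MeasurableSet E ∧ 1 - Real.exp (-c₁ * Real.log p) ≤ μ.real E ∧
        ∀ ω ∈ E, ∀ (w0 : Fin p → ℝ) (w : Fin K → Fin p → ℝ),
          IsAdapted a₁ β w0 → (∀ k, IsAdapted a₁ (δ k) (w k)) →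
          let x := fun o => X o ω
          let y := response x (fun o => eps o ω) β δ
          (lassoSolutions x y lam0 lam1 w0 w).Nonempty ∧
            lassoSolutions x y lam0 lam1 w0 w = oracleSolutions x y β δ := by
  set r : NNReal := ((|M| + 5) / c_n).toNNReal
  have hr : (r : ℝ) = (|M| + 5) / c_n := Real.coe_toNNReal _ (by positivity)
  set C : ℝ := 2 * √(8 * (κ + 1 : NNReal) * (c + 1 : NNReal) * (1 + r) * (|M| + 5)) / a₁
  have hC : 0 < C := by positivity
  refine ⟨C, hC, C, hC, 1, one_pos, ?_⟩
  intro K nT nS p hK hKp hnS Ω _ μ _ X eps hmodel lam0 lam1 hlam0 hlam1 h0 h1 β δ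
  rcases le_or_gt p 1 with hp | hp
  · have hlog : Real.log p ≤ 0 := Real.log_nonpos p.cast_nonneg (by exact_mod_cast hp)
    exact ⟨∅, MeasurableSet.empty, by simpa using hlog, fun ω hω => hω.elim⟩
  have hmodel' := hmodel.mono (le_add_of_nonneg_right zero_le_one : κ ≤ κ + 1)
    (le_add_of_nonneg_right zero_le_one : c ≤ c + 1)
  have hrows : (|M| + 5) * Real.log p ≤ r * nS :=
    calc (|M| + 5) * Real.log p = r * (c_n * Real.log p) := by rw [hr]; field_simp
      _ ≤ r * nS := by gcongr
  have hprob := hmodel'.le_measureReal_correlation_lt (by positivity) (by positivity) hK hp hKp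
    hrows ha₁ hlam0 hlam1 h0 h1 (Function.support (stack (β, δ)))
  exact ⟨_, hmodel'.measurableSet_correlation_lt _ _, by simpa only [neg_one_mul] using hprob,
    fun ω hω w0 w hw0 hw =>
      lassoSolutions_eq_oracleSolutions hlam0 hlam1 (isAdapted_stack hw0 hw) hω⟩

theorem theorem2
    (c_X : ℝ) (hc_X : 0 < c_X) (κ : NNReal) (c_eps : ℝ) (c_n : ℝ) (hc_n : 0 < c_n) (M : ℝ)
    (a a₁ a₂ : ℝ) (ha₁ : 0 < a₁) (ha₂ : 0 ≤ a₂) (ha : a₂ < a) :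
    ∃ C₀ > (0 : ℝ), ∃ C₁ > (0 : ℝ), ∃ c₁ > (0 : ℝ),
      ∀ (K nT nS p : ℕ), 1 ≤ K →
        Real.log K ≤ M * Real.log p →
        c_n * Real.log p ≤ nS →
      ∀ (Ω : Type*) [MeasurableSpace Ω] (μ : MeasureTheory.Measure Ω)
        [MeasureTheory.IsProbabilityMeasure μ]
        (X : AdaTrans.Obs K nT nS → Ω → Fin p → ℝ) (eps : AdaTrans.Obs K nT nS → Ω → ℝ)
        (Sig : Fin (K + 1) → Matrix (Fin p) (Fin p) ℝ) (v : Fin (K + 1) → NNReal),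
        AdaTrans.DesignAssumption μ X Sig κ c_X →
        AdaTrans.NoiseAssumption μ X eps v c_eps →
      ∀ (lam0 lam1 : ℝ), 0 < lam0 → 0 < lam1 →
        C₀ * Real.sqrt (Real.log p / AdaTrans.totalSize K nT nS) ≤ lam0 →
        C₁ * ((nS : ℝ) / AdaTrans.totalSize K nT nS * Real.sqrt (Real.log p / nS)) ≤ lam1 →
      ∀ (h0 : ℝ) (h : Fin K → ℝ),
        3 * a / 2 * lam0 ≤ h0 → (∀ k, 3 * a / 2 * lam1 ≤ h k) →
      ∀ (β : Fin p → ℝ) (δ : Fin K → Fin p → ℝ), (β, δ) ∈ AdaTrans.Theta1 h0 h →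
      ∀ R : ℝ → ℝ → ℝ, AdaTrans.IsFoldedConcave R a a₁ a₂ →
      ∀ (b_init : Ω → Fin p → ℝ) (d_init : Ω → Fin K → Fin p → ℝ),
      ∃ E : Set Ω, MeasurableSet E ∧ 1 - Real.exp (-c₁ * Real.log p) ≤ μ.real E ∧
        ∀ ω ∈ E, AdaTrans.Accurate a₂ lam0 lam1 β δ (b_init ω) (d_init ω) →
          let x := fun o => X o ω
          let y := AdaTrans.response x (fun o => eps o ω) β δ
          let S := AdaTrans.lassoSolutions x y lam0 lam1
            (fun j => AdaTrans.weight R lam0 (b_init ω j))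
            (fun k j => AdaTrans.weight R lam1 (d_init ω k j))
          S.Nonempty ∧ S = AdaTrans.oracleSolutions x y β δ := by
  obtain ⟨C₀, hC₀, C₁, hC₁, c₁, hc₁, H⟩ := theorem2_general κ c_eps.toNNReal hc_n M ha₁
  refine ⟨C₀, hC₀, C₁, hC₁, c₁, hc₁, ?_⟩
  intro K nT nS p hK hKp hnS Ω _ μ _ X eps Sig v hX heps lam0 lam1 hlam0 hlam1 h0 h1 h0' h hh0 hh
    β δ hθ R hR b_init d_init
  obtain ⟨E, hE, hprob, hsol⟩ := H K nT nS p hK hKp hnS Ω μ X eps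
    (isSubGaussianModel_of_assumptions hX heps) lam0 lam1 hlam0.le hlam1.le h0 h1 β δ
  exact ⟨E, hE, hprob, fun ω hω hacc => hsol ω hω _ _
    (isAdapted_weight hR ha hlam0 hh0 hθ.1 hacc.1) fun k =>
      isAdapted_weight hR ha hlam1 (hh k) (hθ.2 k) (hacc.2 k)⟩
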